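/- **Model.** A dynamic network has $n\ge 1$ nodes and operates in synchronized rounds $0,1,2,\dots$. In round $t$ an adversary chooses a connected undirected graph $G(t)$ on the nodes; each node broadcasts an $O(b)$-bit message, chosen without knowing $G(t)$, and then receives the messages of its neighbours in $G(t)$ (and knows which neighbour sent which message). The network is *$T$-stable* ($T\ge 1$) if $G$ is constant on each block $iT,\dots,(i+1)T-1$ of rounds. In *$k$-token dissemination*, $k\le n$ tokens of $d\le b$ bits, with $b\ge 1$ and $b\ge\log_2 n$, are chosen by the adversary and placed at nodes before the first round, each token at one or more nodes; every node has to output all $k$ tokens and terminate (a terminated node sends nothing more). In a *centralized* algorithm the behaviour of a node may depend, besides on its identity, its own tokens and the messages it has received, on the initial distribution of the tokens (which node holds which tokens, not their contents), on all past topologies, and, if the algorithm is randomized, on a source of shared random bits, fresh ones being drawn in each round. The parameters $n,k,d,b,T$ are known, and local computation is unrestricted. The adversary is adaptive: it chooses $G(t)$ knowing the algorithm, the input, and the random bits of all rounds before $t$, but not those of round $t$. The algorithm is a *network coding* algorithm if every message, viewed as a vector over $\mathbb F_2$, is an $\mathbb F_2$-linear function of the tokens initially held and the messages received by its sender, with coefficients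 that may depend on the sender's identity, the round and the common knowledge above. **Statement.** All implied constants are absolute. 1. For all $n,k,d,b,T$ as above there is a randomized centralized network coding algorithm with $O(b)$-bit messages that, on every input and against every adaptive adversary that keeps the network connected and $T$-stable, always terminates with all tokens disseminated, and does so within $O(n)$ rounds with probability at least $1-2^{-n}$. This is order-optimal, so that the running time is $\Theta(n)$: if $1\le k\le n$, $d\ge 1$ and $T\ge 1$, then every randomized centralized algorithm (network coding or not, with messages of any size) that, on every input and against every such adversary, disseminates all tokens and terminates within $R$ rounds with probability at least $1-2^{-n}$ satisfies $R\ge n-1$. 2. For all $n,k,d,b,T$ as above there is a deterministic centralized network coding algorithm with $O(b)$-bit messages that, on every input and in every connected $T$-stable dynamic network, disseminates all tokens and terminates within $$O\!\left(\frac{\log n}{bT}\cdot n\cdot\min\{k,\tfrac nT\}+n\right)$$ rounds. -/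

import Mathlib

open MeasureTheory

namespace DynamicNetwork

/-- Strings of `m` bits, viewed as the vector space `F₂^m`. -/
abbrev Bits (m : ℕ) : Type := Fin m → ZMod 2

/-- The shared random bits that are drawn in one round (`s` of them; `s = 0`: none). -/
abbrev Coin (s : ℕ) : Type := Fin s → Bool

/-- An initial token distribution: which of the `k` tokens each node holds
(a token may be held by several nodes). The contents of the tokens are not part of it. -/
abbrev Placement (n k : ℕ) : Type := Fin n → Finset (Fin k)

/-- An input of `k`-token dissemination: `k` tokens of `d` bits each, and their initial
distribution, where every token is held by at least one node. -/
structure Input (n k d : ℕ) where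
  holds : Placement n k
  token : Fin k → Bits d
  held : ∀ i, ∃ v, i ∈ holds v

/-- The private information of a node after `t` rounds: the tokens it was given
(with `0` in the place of a token it does not hold), and, for each past round and each node `u`,
the message received from `u` in that round (`0` if `u` was not a neighbour; this is not confused
with a received zero message because the past topologies are known to the nodes). -/
abbrev View (n k d m t : ℕ) : Type := (Fin k → Bits d) × (Fin t → Fin n → Bits m)

/-- A centralized algorithm with `m`-bit messages and `s` shared random bits per round.
What a node does may depend on its identity, on its private information, and on the
common knowledge: the initial token distribution, the past topologies, and the shared random bits
drawn so far. Local computation is unrestricted.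

* `message t` is the message broadcast in round `t` (rounds are numbered `0, 1, …`): it may use
  the random bits of rounds `0, …, t` but only the topologies of rounds `0, …, t - 1`.
* `output t` is the decision after `t` rounds: `none` to go on, `some x` to terminate with
  output `x`. -/
structure CentralizedAlgorithm (n k d m s : ℕ) where
  message : (t : ℕ) → Placement n k → (Fin t → SimpleGraph (Fin n)) → (Fin (t + 1) → Coin s) →
    Fin n → View n k d m t → Bits m
  output : (t : ℕ) → Placement n k → (Fin t → SimpleGraph (Fin n)) → (Fin t → Coin s) →
    Fin n → View n k d m t → Option (Fin k → Bits d)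

/-- An adaptive adversary: it chooses the topology of round `t` knowing the random bits of all
earlier rounds, hence (algorithm and input being fixed beforehand) all past actions and the
current state of all nodes, but not the random bits of round `t`. -/
abbrev Adversary (n s : ℕ) : Type := (t : ℕ) → (Fin t → Coin s) → SimpleGraph (Fin n)

/-- The sequence of topologies that arises from the random bits `ω`. -/
def Adversary.graphs {n s : ℕ} (adv : Adversary n s) (ω : ℕ → Coin s) (t : ℕ) :
    SimpleGraph (Fin n) :=
  adv t (fun i => ω i)

/-- A dynamic network that is connected in every round and `T`-stable: the topology is constant
on each block `iT, …, (i + 1)T - 1` of `T` consecutive rounds. -/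
def IsStableNetwork {n : ℕ} (T : ℕ) (G : ℕ → SimpleGraph (Fin n)) : Prop :=
  (∀ t, (G t).Connected) ∧ ∀ t t', t / T = t' / T → G t = G t'

/-- The adversary always produces a connected `T`-stable dynamic network. -/
def Adversary.IsStable {n s : ℕ} (adv : Adversary n s) (T : ℕ) : Prop :=
  ∀ ω, IsStableNetwork T (adv.graphs ω)

namespace CentralizedAlgorithm

variable {n k d m s : ℕ}

/-- A network coding algorithm: every message is a linear function, over `F₂`, of the initial
tokens and the received messages of its sender. The coefficients may depend on the common
knowledge and on the identity of the sender. -/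
def IsNetworkCoding (A : CentralizedAlgorithm n k d m s) : Prop :=
  ∀ (t : ℕ) (p : Placement n k) (G : Fin t → SimpleGraph (Fin n)) (c : Fin (t + 1) → Coin s)
    (v : Fin n), IsLinearMap (ZMod 2) (A.message t p G c v)

open Classical in
/-- The private information of node `v` after `t` rounds on the topologies `G`, if
`sent τ u` is the message that `u` has broadcast in round `τ`. -/
noncomputable def view (I : Input n k d) (G : ℕ → SimpleGraph (Fin n)) {t : ℕ}
    (sent : Fin t → Fin n → Bits m) (v : Fin n) : View n k d m t :=
  (fun i => if i ∈ I.holds v then I.token i else 0,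
   fun τ u => if (G τ).Adj u v then sent τ u else 0)

/-- The decision of node `v` after `t` rounds. -/
noncomputable def decision (A : CentralizedAlgorithm n k d m s) (I : Input n k d) (G : ℕ → SimpleGraph (Fin n))
    (ω : ℕ → Coin s) {t : ℕ} (sent : Fin t → Fin n → Bits m) (v : Fin n) :
    Option (Fin k → Bits d) :=
  A.output t I.holds (fun i => G i) (fun i => ω i) v (view I G sent v)

/-- The execution up to the end of `t` rounds: the messages broadcast in these rounds, and for each
node `some x` if it has terminated with output `x`, and `none` if it has not terminated.
A node that has terminated is silent (it sends `0`) and keeps its output forever. -/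
noncomputable def run (A : CentralizedAlgorithm n k d m s) (I : Input n k d) (G : ℕ → SimpleGraph (Fin n))
    (ω : ℕ → Coin s) :
    (t : ℕ) → (Fin t → Fin n → Bits m) × (Fin n → Option (Fin k → Bits d))
  | 0 => (Fin.elim0, fun v => A.decision I G ω (t := 0) Fin.elim0 v)
  | t + 1 =>
    let sent := (A.run I G ω t).1
    let result := (A.run I G ω t).2
    let sent' : Fin (t + 1) → Fin n → Bits m := Fin.snoc sent fun v =>
      if (result v).isSome then 0
      else A.message t I.holds (fun i => G i) (fun i => ω i) v (view I G sent v)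
    (sent', fun v => if (result v).isSome then result v else A.decision I G ω sent' v)

/-- After `t` rounds all nodes have terminated, and each of them has output all `k` tokens. -/
def SolvedBy (A : CentralizedAlgorithm n k d m s) (I : Input n k d) (adv : Adversary n s)
    (ω : ℕ → Coin s) (t : ℕ) : Prop :=
  ∀ v, (A.run I (adv.graphs ω) ω t).2 v = some I.token

end CentralizedAlgorithm

/-- The law of the shared random bits: independent fair bits, `s` of them in each round. -/
noncomputable def coinMeasure (s : ℕ) : Measure (ℕ → Coin s) :=
  Measure.infinitePi fun _ : ℕ => (PMF.uniformOfFintype (Coin s)).toMeasure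

namespace CentralizedAlgorithm

variable {n k d m s : ℕ}

/-- On every input, against every `T`-stable adversary and for all outcomes of the random bits, all
nodes eventually terminate with all tokens. -/
def IsLasVegas (A : CentralizedAlgorithm n k d m s) (T : ℕ) : Prop :=
  ∀ (I : Input n k d) (adv : Adversary n s), adv.IsStable T →
    ∀ ω, ∃ t, A.SolvedBy I adv ω t

/-- On every input and against every `T`-stable adversary, with probability at least `p` all nodes
terminate with all tokens within `R` rounds. -/
def SolvesWithProb (A : CentralizedAlgorithm n k d m s) (T R : ℕ) (p : ℝ) : Prop :=
  ∀ (I : Input n k d) (adv : Adversary n s), adv.IsStable T →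
    p ≤ (coinMeasure s).real {ω | A.SolvedBy I adv ω R}

/-- On every input, against every `T`-stable adversary and for all outcomes of the random bits, all
nodes terminate with all tokens within `R` rounds. -/
def SolvesSurely (A : CentralizedAlgorithm n k d m s) (T R : ℕ) : Prop :=
  ∀ (I : Input n k d) (adv : Adversary n s), adv.IsStable T →
    ∀ ω, A.SolvedBy I adv ω R

end CentralizedAlgorithm

end DynamicNetwork

open DynamicNetwork

/-!
Every message is a linear combination of the tokens over the field with `q ^ 3` elements, where
`q = 2 ^ b ≥ n`, so a node knows a subspace of coefficient vectors and can decode once it knows the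
whole space. A functional is told apart from zero by some nodes; give it weight exponential in the
number of the other nodes. When all aware nodes send vectors on which the functional does not
vanish, then, in whatever connected graph, another node becomes aware of it. A functional for which
this fails keeps at most its weight, and which functionals fail depends only on the vectors sent,
not on the topology. For random vectors the expected weight of those functionals is a fraction
`n / q ^ 3` of the total, so suitable vectors can be fixed deterministically before the topology is
known. The total weight then drops by the factor `q` per round and is exhausted after `5n` rounds.

A deterministic algorithm is a randomized one that draws no bits, and its running time `O(n)` is
within the deterministic bound for every `T`, so one algorithm serves both parts. The lower bound
holds because on a path with all tokens at one end, nothing about their contents reaches the other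
end before round `n - 1`.
-/

namespace DynamicNetwork

section Potential

open Finset Module

variable {K E ι : Type*} [Field K] [AddCommGroup E] [Module K E]

/-- What the nodes know after a round with topology `G`, if before it node `v` knows the subspace
`V v` of coefficient vectors, and in it node `u` sends the vector `x u` that it knows. -/
def spread (V : ι → Submodule K E) (x : ∀ u, V u) (G : SimpleGraph ι) (v : ι) : Submodule K E :=
  V v ⊔ Submodule.span K ((fun u => (x u : E)) '' {u | G.Adj u v})

theorem le_spread (V : ι → Submodule K E) (x : ∀ u, V u) (G : SimpleGraph ι) :
    V ≤ spread V x G :=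
  fun _ => le_sup_left

theorem coe_mem_spread {V : ι → Submodule K E} (x : ∀ u, V u) {G : SimpleGraph ι} {u v : ι}
    (h : G.Adj u v) : (x u : E) ∈ spread V x G v :=
  Submodule.mem_sup_right (Submodule.subset_span ⟨u, h, rfl⟩)

theorem natCard_ker_mul_natCard {μ : Dual K E} (hμ : μ ≠ 0) :
    Nat.card (LinearMap.ker μ) * Nat.card K = Nat.card E := by
  rw [Submodule.card_eq_card_quotient_mul_card (LinearMap.ker μ),
    Nat.card_congr (μ.quotKerEquivOfSurjective (LinearMap.surjective hμ)).toEquiv]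

theorem natCard_dual [FiniteDimensional K E] : Nat.card (Dual K E) = Nat.card E := by
  rw [natCard_eq_pow_finrank (K := K), natCard_eq_pow_finrank (K := K) (V := E),
    Subspace.dual_finrank_eq]

theorem exists_adj_of_mem_of_notMem {G : SimpleGraph ι} (hG : G.Connected) {S : Set ι} {u v : ι}
    (hu : u ∈ S) (hv : v ∉ S) : ∃ u' ∈ S, ∃ v' ∉ S, G.Adj u' v' := by
  obtain ⟨w⟩ := hG.preconnected u v
  obtain ⟨e, -, he, he'⟩ := w.exists_boundary_dart S hu hv
  exact ⟨e.fst, he, e.snd, he', e.adj⟩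

variable [Fintype ι]

open Classical in
/-- The nodes that cannot tell the functional `μ` from the zero functional by what they know. -/
noncomputable def unaware (V : ι → Submodule K E) (μ : Dual K E) : Finset ι :=
  {v | V v ≤ LinearMap.ker μ}

theorem mem_unaware {V : ι → Submodule K E} {μ : Dual K E} {v : ι} :
    v ∈ unaware V μ ↔ V v ≤ LinearMap.ker μ := by
  simp [unaware]

theorem unaware_anti {V W : ι → Submodule K E} (h : V ≤ W) (μ : Dual K E) :
    unaware W μ ⊆ unaware V μ :=
  fun v hv => mem_unaware.2 ((h v).trans (mem_unaware.1 hv))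

theorem exists_notMem_unaware {V : ι → Submodule K E} (hV : ⨆ v, V v = ⊤) {μ : Dual K E}
    (hμ : μ ≠ 0) : ∃ v, v ∉ unaware V μ := by
  by_contra! h
  exact hμ (LinearMap.ker_eq_top.1 (top_le_iff.1 (hV ▸ iSup_le fun v => mem_unaware.1 (h v))))

/-- The functional `μ` is lost if some node that is aware of it sends a vector on which it
vanishes. -/
def IsLost (V : ι → Submodule K E) (x : ∀ u, V u) (μ : Dual K E) : Prop :=
  ∃ u ∉ unaware V μ, μ (x u) = 0

theorem card_unaware_spread_lt {V : ι → Submodule K E} (hV : ⨆ v, V v = ⊤) {x : ∀ u, V u}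
    {G : SimpleGraph ι} (hG : G.Connected) {μ : Dual K E} (hμ : μ ≠ 0) (hlost : ¬ IsLost V x μ)
    (hne : (unaware V μ).Nonempty) : #(unaware (spread V x G) μ) < #(unaware V μ) := by
  obtain ⟨u₀, hu₀⟩ := exists_notMem_unaware hV hμ
  obtain ⟨v₀, hv₀⟩ := hne
  obtain ⟨v, hv, u, hu, hvu⟩ :=
    exists_adj_of_mem_of_notMem hG (S := unaware V μ) (mem_coe.2 hv₀) (mem_coe.not.2 hu₀)
  have hv' : v ∉ unaware (spread V x G) μ := fun h =>
    hlost ⟨u, hu, mem_unaware.1 h (coe_mem_spread x hvu.symm)⟩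
  exact card_lt_card ((ssubset_iff_of_subset (unaware_anti (le_spread V x G) μ)).2 ⟨v, hv, hv'⟩)

/-- The contribution of the functional `μ` to the potential. It is `0` once all nodes are aware of
`μ`. -/
noncomputable def weight (a : ℝ) (V : ι → Submodule K E) (μ : Dual K E) : ℝ :=
  a ^ #(unaware V μ) - 1

theorem weight_nonneg {a : ℝ} (ha : 1 ≤ a) (V : ι → Submodule K E) (μ : Dual K E) :
    0 ≤ weight a V μ :=
  sub_nonneg.2 (one_le_pow₀ ha)

theorem weight_anti {a : ℝ} (ha : 1 ≤ a) {V W : ι → Submodule K E} (h : V ≤ W) (μ : Dual K E) :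
    weight a W μ ≤ weight a V μ :=
  sub_le_sub_right (pow_le_pow_right₀ ha (card_le_card (unaware_anti h μ))) 1

theorem weight_spread_le {a : ℝ} (ha : 1 ≤ a) {V : ι → Submodule K E} (hV : ⨆ v, V v = ⊤)
    {x : ∀ u, V u} {G : SimpleGraph ι} (hG : G.Connected) {μ : Dual K E} (hμ : μ ≠ 0)
    (hlost : ¬ IsLost V x μ) : weight a (spread V x G) μ ≤ a⁻¹ * weight a V μ := by
  have ha0 : 0 < a := by linarith
  rcases (unaware V μ).eq_empty_or_nonempty with hempty | hne
  · have hempty' : unaware (spread V x G) μ = ∅ :=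
      subset_empty.1 (hempty ▸ unaware_anti (le_spread V x G) μ)
    simp [weight, hempty, hempty']
  · have hpow : a ^ #(unaware (spread V x G) μ) * a ≤ a ^ #(unaware V μ) := by
      rw [← pow_succ]
      exact pow_le_pow_right₀ ha (card_unaware_spread_lt hV hG hμ hlost hne)
    rw [← div_eq_inv_mul, le_div_iff₀ ha0, weight, weight]
    linarith

theorem natCard_apply_eq_zero_mul_natCard {V : ι → Submodule K E} {μ : Dual K E} {u : ι}
    (hu : u ∉ unaware V μ) :
    Nat.card {x : ∀ u, V u // μ (x u) = 0} * Nat.card K = Nat.card (∀ u, V u) := by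
  classical
  obtain ⟨y, hy, hμy⟩ := SetLike.not_le_iff_exists.1 (mem_unaware.not.1 hu)
  let ν : Dual K (∀ u, V u) := μ ∘ₗ (V u).subtype ∘ₗ LinearMap.proj u
  have hν : ν ≠ 0 := fun h => hμy (by
    simpa [ν] using LinearMap.congr_fun h (Pi.single u ⟨y, hy⟩))
  exact natCard_ker_mul_natCard hν

theorem natCard_isLost_mul_natCard_le (V : ι → Submodule K E) (μ : Dual K E) :
    Nat.card {x : ∀ u, V u // IsLost V x μ} * Nat.card K ≤
      Fintype.card ι * Nat.card (∀ u, V u) := by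
  classical
  have hunion : {x : ∀ u, V u | IsLost V x μ} =
      ⋃ u ∈ ((unaware V μ)ᶜ : Finset ι), {x : ∀ u, V u | μ (x u) = 0} := by
    ext x
    simp [IsLost]
  calc Nat.card {x : ∀ u, V u // IsLost V x μ} * Nat.card K
      ≤ (∑ u ∈ (unaware V μ)ᶜ, Nat.card {x : ∀ u, V u // μ (x u) = 0}) * Nat.card K := by
        gcongr
        change Set.ncard {x : ∀ u, V u | IsLost V x μ} ≤ _
        rw [hunion]
        exact set_ncard_biUnion_le _ _
    _ = ∑ _u ∈ (unaware V μ)ᶜ, Nat.card (∀ u, V u) := by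
        rw [sum_mul]
        exact sum_congr rfl fun u hu =>
          natCard_apply_eq_zero_mul_natCard (mem_compl.1 hu)
    _ ≤ Fintype.card ι * Nat.card (∀ u, V u) := by
        rw [sum_const, smul_eq_mul]
        gcongr
        exact card_le_univ _

variable [Finite K] [Finite E]

noncomputable local instance : Fintype (Dual K E) :=
  have : Finite (Dual K E) := DFunLike.finite _
  Fintype.ofFinite _

open Classical in
/-- The potential of a state of knowledge. It is small only if all nodes know everything. -/
noncomputable def potential (a : ℝ) (V : ι → Submodule K E) : ℝ :=
  ∑ μ : Dual K E with μ ≠ 0, weight a V μ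

theorem potential_nonneg {a : ℝ} (ha : 1 ≤ a) (V : ι → Submodule K E) : 0 ≤ potential a V :=
  sum_nonneg fun μ _ => weight_nonneg ha V μ

open Classical in
/-- The part of the potential that comes from lost functionals. -/
noncomputable def lostPotential (a : ℝ) (V : ι → Submodule K E) (x : ∀ u, V u) : ℝ :=
  ∑ μ : Dual K E with μ ≠ 0, if IsLost V x μ then weight a V μ else 0

theorem eq_top_of_potential_lt {a : ℝ} (ha : 1 ≤ a) {V : ι → Submodule K E}
    (h : potential a V < a - 1) (v : ι) : V v = ⊤ := by
  classical
  by_contra hv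
  obtain ⟨μ, hμ, hle⟩ := (V v).exists_le_ker_of_lt_top (lt_top_iff_ne_top.2 hv)
  have hcard : 1 ≤ #(unaware V μ) := card_pos.2 ⟨v, mem_unaware.2 hle⟩
  refine h.not_ge ?_
  calc a - 1 ≤ weight a V μ := sub_le_sub_right (le_self_pow₀ ha (by omega)) 1
    _ ≤ potential a V :=
        single_le_sum (f := weight a V) (fun _ _ => weight_nonneg ha V _) (by simpa using hμ)

theorem potential_le {a : ℝ} (ha : 1 ≤ a) (V : ι → Submodule K E) :
    potential a V ≤ Nat.card E * a ^ Fintype.card ι := by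
  classical
  calc potential a V
      ≤ ∑ μ : Dual K E, weight a V μ :=
        sum_le_sum_of_subset_of_nonneg (subset_univ _) fun μ _ _ => weight_nonneg ha V μ
    _ ≤ ∑ _μ : Dual K E, a ^ Fintype.card ι := by
        refine sum_le_sum fun μ _ => (sub_le_self _ zero_le_one).trans ?_
        exact pow_le_pow_right₀ ha (card_le_univ _)
    _ = Nat.card E * a ^ Fintype.card ι := by
        rw [sum_const, nsmul_eq_mul, card_univ, ← Nat.card_eq_fintype_card, natCard_dual]

theorem potential_spread_le {a : ℝ} (ha : 1 ≤ a) {V : ι → Submodule K E} (hV : ⨆ v, V v = ⊤)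
    (x : ∀ u, V u) {G : SimpleGraph ι} (hG : G.Connected) :
    potential a (spread V x G) ≤ lostPotential a V x + a⁻¹ * potential a V := by
  classical
  rw [potential, potential, lostPotential, mul_sum, ← sum_add_distrib]
  refine sum_le_sum fun μ hμ => ?_
  have hnonneg : 0 ≤ a⁻¹ * weight a V μ :=
    mul_nonneg (inv_nonneg.2 (by linarith)) (weight_nonneg ha V μ)
  split_ifs with hlost
  · linarith [weight_anti ha (le_spread V x G) μ]
  · linarith [weight_spread_le ha hV hG (mem_filter.1 hμ).2 hlost]

theorem exists_lostPotential_le {a : ℝ} (ha : 1 ≤ a) (V : ι → Submodule K E) :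
    ∃ x : ∀ u, V u, lostPotential a V x ≤ Fintype.card ι / Nat.card K * potential a V := by
  classical
  have := Fintype.ofFinite (∀ u, V u)
  have hK : (0 : ℝ) < Nat.card K := by exact_mod_cast Nat.card_pos
  suffices h : ∑ x, lostPotential a V x ≤
      ∑ _x : ∀ u, V u, Fintype.card ι / Nat.card K * potential a V by
    obtain ⟨x, -, hx⟩ := exists_le_of_sum_le univ_nonempty h
    exact ⟨x, hx⟩
  have hlost (μ : Dual K E) : ∑ x, (if IsLost V x μ then weight a V μ else 0) ≤
      Nat.card (∀ u, V u) * (Fintype.card ι / Nat.card K * weight a V μ) := by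
    have hcard : (Nat.card {x : ∀ u, V u // IsLost V x μ} : ℝ) ≤
        Fintype.card ι * Nat.card (∀ u, V u) / Nat.card K := by
      rw [le_div_iff₀ hK]
      exact_mod_cast natCard_isLost_mul_natCard_le V μ
    calc ∑ x, (if IsLost V x μ then weight a V μ else 0)
        = Nat.card {x : ∀ u, V u // IsLost V x μ} * weight a V μ := by
          rw [← sum_filter, sum_const, nsmul_eq_mul, Nat.card_eq_fintype_card,
            Fintype.card_subtype]
      _ ≤ Fintype.card ι * Nat.card (∀ u, V u) / Nat.card K * weight a V μ :=
          mul_le_mul_of_nonneg_right hcard (weight_nonneg ha V μ)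
      _ = Nat.card (∀ u, V u) * (Fintype.card ι / Nat.card K * weight a V μ) := by ring
  calc ∑ x, lostPotential a V x
      = ∑ μ : Dual K E with μ ≠ 0, ∑ x, if IsLost V x μ then weight a V μ else 0 := sum_comm
    _ ≤ ∑ μ : Dual K E with μ ≠ 0,
          Nat.card (∀ u, V u) * (Fintype.card ι / Nat.card K * weight a V μ) :=
        sum_le_sum fun μ _ => hlost μ
    _ = ∑ _x : ∀ u, V u, Fintype.card ι / Nat.card K * potential a V := by
        rw [← mul_sum, ← mul_sum, sum_const, nsmul_eq_mul, card_univ, Nat.card_eq_fintype_card,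
          potential]

theorem exists_potential_spread_le {a : ℝ} (ha : 1 ≤ a) {V : ι → Submodule K E}
    (hV : ⨆ v, V v = ⊤) : ∃ x : ∀ u, V u, ∀ G : SimpleGraph ι, G.Connected →
      potential a (spread V x G) ≤ (Fintype.card ι / Nat.card K + a⁻¹) * potential a V := by
  obtain ⟨x, hx⟩ := exists_lostPotential_le ha V
  refine ⟨x, fun G hG => (potential_spread_le ha hV x hG).trans ?_⟩
  rw [add_mul]
  exact add_le_add_left hx _

end Potential

section Coding

variable {n k d m s : ℕ} {K : Type*} [Field K]

/-- A rule for choosing the vector that each node sends, given what every node knows. The choice is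
made before the topology of the round is known. -/
abbrev Strategy (n k : ℕ) (K : Type*) [Field K] : Type _ :=
  (V : Fin n → Submodule K (Fin k → K)) → ∀ u, V u

/-- The coefficient vectors that node `v` knows initially: those supported on its own tokens. -/
def initialKnowledge (K : Type*) [Field K] (p : Placement n k) (v : Fin n) :
    Submodule K (Fin k → K) :=
  Submodule.span K ((fun i => Pi.single i 1) '' (p v : Set (Fin k)))

theorem iSup_initialKnowledge (I : Input n k d) : ⨆ v, initialKnowledge K I.holds v = ⊤ := by
  rw [eq_top_iff, ← (Pi.basisFun K (Fin k)).span_eq, Submodule.span_le]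
  rintro _ ⟨i, rfl⟩
  obtain ⟨v, hv⟩ := I.held i
  rw [Pi.basisFun_apply]
  exact Submodule.mem_iSup_of_mem v (Submodule.subset_span ⟨i, hv, rfl⟩)

/-- The coefficient vectors known to each node after `t` rounds, if the strategy `σ` is followed. -/
def Strategy.knowledge (σ : Strategy n k K) (p : Placement n k) :
    (t : ℕ) → (Fin t → SimpleGraph (Fin n)) → Fin n → Submodule K (Fin k → K)
  | 0, _ => initialKnowledge K p
  | t + 1, G =>
    let V := σ.knowledge p t (Fin.init G)
    spread V (σ V) (G (Fin.last t))

/-- The coefficient vector of the message that node `u` sends in round `τ`. -/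
def Strategy.vector (σ : Strategy n k K) (p : Placement n k) {t : ℕ}
    (G : Fin t → SimpleGraph (Fin n)) (τ : Fin t) (u : Fin n) : Fin k → K :=
  σ (σ.knowledge p τ (Fin.take τ τ.is_le' G)) u

theorem Strategy.iSup_knowledge (σ : Strategy n k K) (I : Input n k d) :
    ∀ {t : ℕ} (G : Fin t → SimpleGraph (Fin n)), ⨆ v, σ.knowledge I.holds t G v = ⊤
  | 0, _ => iSup_initialKnowledge I
  | _ + 1, G => top_le_iff.1 <| (σ.iSup_knowledge I (Fin.init G)).ge.trans <|
      iSup_mono (le_spread _ _ _)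

theorem Strategy.knowledge_le (σ : Strategy n k K) (p : Placement n k) {v : Fin n}
    {D : Submodule K (Fin k → K)} (hinit : ∀ i ∈ p v, Pi.single i 1 ∈ D) :
    ∀ {t : ℕ} {G : Fin t → SimpleGraph (Fin n)},
      (∀ τ u, (G τ).Adj u v → σ.vector p G τ u ∈ D) → σ.knowledge p t G v ≤ D
  | 0, _, _ => Submodule.span_le.2 (by simpa [Set.subset_def] using hinit)
  | t + 1, _, hD => sup_le (σ.knowledge_le p hinit fun τ u h => hD τ.castSucc u h)
      (Submodule.span_le.2 (by rintro _ ⟨u, h, rfl⟩; exact hD (Fin.last t) u h))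

theorem exists_comp_eq_of_ker_le {F U V W : Type*} [Field F] [AddCommGroup U] [Module F U]
    [AddCommGroup V] [Module F V] [AddCommGroup W] [Module F W] {f : U →ₗ[F] V} {g : U →ₗ[F] W}
    (h : LinearMap.ker f ≤ LinearMap.ker g) : ∃ L : V →ₗ[F] W, L ∘ₗ f = g := by
  obtain ⟨L, hL⟩ := ((LinearMap.ker f).liftQ g h ∘ₗ
    f.quotKerEquivRange.symm.toLinearMap).exists_extend
  refine ⟨L, LinearMap.ext fun x => ?_⟩
  have hx := LinearMap.congr_fun hL ⟨f x, x, rfl⟩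
  have hsymm : f.quotKerEquivRange.symm ⟨f x, x, rfl⟩ = Submodule.Quotient.mk x :=
    (LinearEquiv.symm_apply_eq _).2 rfl
  simpa [hsymm] using hx

variable [Algebra (ZMod 2) K]

/-- The linear combination with coefficient vector `x` of the tokens, after each of them is
embedded into `K`. -/
def combination (emb : Bits d →ₗ[ZMod 2] K) (x : Fin k → K) : (Fin k → Bits d) →ₗ[ZMod 2] K :=
  ∑ i, x i • emb ∘ₗ LinearMap.proj i

theorem combination_apply (emb : Bits d →ₗ[ZMod 2] K) (x : Fin k → K) (tok : Fin k → Bits d) :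
    combination emb x tok = ∑ i, x i * emb (tok i) := by
  simp [combination]

variable (enc : K ≃ₗ[ZMod 2] Bits m) (emb : Bits d →ₗ[ZMod 2] K)

namespace Strategy

variable (σ : Strategy n k K)

open Classical in
/-- The private information of node `v` as a linear function of all the tokens, if every message
encodes the combination of the tokens that `σ` prescribes. -/
noncomputable def codedView (p : Placement n k) {t : ℕ} (G : Fin t → SimpleGraph (Fin n))
    (v : Fin n) : (Fin k → Bits d) →ₗ[ZMod 2] View n k d m t :=
  LinearMap.prod
    (LinearMap.pi fun i => if i ∈ p v then LinearMap.proj i else 0)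
    (LinearMap.pi fun τ => LinearMap.pi fun u =>
      if (G τ).Adj u v then enc.toLinearMap ∘ₗ combination emb (σ.vector p G τ u) else 0)

variable {emb}

theorem combination_eq_zero_of_codedView_eq_zero {p : Placement n k} {t : ℕ}
    {G : Fin t → SimpleGraph (Fin n)} {v : Fin n} {x : Fin k → K} (hx : x ∈ σ.knowledge p t G v)
    {tok : Fin k → Bits d} (htok : σ.codedView enc emb p G v tok = 0) :
    combination emb x tok = 0 := by
  have hmem {y : Fin k → K} :
      y ∈ LinearMap.ker (Fintype.linearCombination K fun i => emb (tok i)) ↔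
        combination emb y tok = 0 := by
    simp [Fintype.linearCombination_apply, combination_apply]
  refine hmem.1 (σ.knowledge_le p (fun i hi => ?_) (fun τ u hadj => hmem.2 ?_) hx)
  · have htok_i : tok i = 0 := by
      simpa [codedView, hi] using congrFun (congrArg Prod.fst htok) i
    simp [htok_i]
  · simpa [codedView, hadj] using congrFun (congrFun (congrArg Prod.snd htok) τ) u

theorem exists_encoder (p : Placement n k) {t : ℕ} (G : Fin t → SimpleGraph (Fin n)) (v : Fin n) :
    ∃ L : View n k d m t →ₗ[ZMod 2] Bits m, L ∘ₗ σ.codedView enc emb p G v =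
      enc.toLinearMap ∘ₗ combination emb (σ (σ.knowledge p t G) v) :=
  exists_comp_eq_of_ker_le fun tok htok => by
    simp [σ.combination_eq_zero_of_codedView_eq_zero enc (Subtype.property _) htok]

theorem codedView_injective (hemb : Function.Injective emb) {p : Placement n k} {t : ℕ}
    {G : Fin t → SimpleGraph (Fin n)} {v : Fin n} (hv : σ.knowledge p t G v = ⊤) :
    Function.Injective (σ.codedView enc emb p G v) := by
  refine (injective_iff_map_eq_zero _).2 fun tok htok => funext fun i => hemb ?_
  have hcomb : combination emb (Pi.single i 1) tok = 0 :=
    σ.combination_eq_zero_of_codedView_eq_zero enc (hv ▸ Submodule.mem_top) htok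
  simpa [combination_apply, Pi.single_apply] using hcomb

variable (emb)

/-- The deterministic network coding algorithm that follows the strategy `σ` for `R` rounds, after
which each node decodes its private information and terminates. -/
noncomputable def algorithm (R : ℕ) : CentralizedAlgorithm n k d m s where
  message _ p G _ v := (σ.exists_encoder enc (emb := emb) p G v).choose
  output t p G _ v w :=
    if t = R then some (Function.invFun (σ.codedView enc emb p G v) w) else none

theorem algorithm_isNetworkCoding (R : ℕ) :
    (σ.algorithm (s := s) enc emb R).IsNetworkCoding :=
  fun _ _ _ _ _ => LinearMap.isLinear _

theorem message_codedView (R : ℕ) (p : Placement n k) {t : ℕ} (G : Fin t → SimpleGraph (Fin n))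
    (c : Fin (t + 1) → Coin s) (v : Fin n) (tok : Fin k → Bits d) :
    (σ.algorithm enc emb R).message t p G c v (σ.codedView enc emb p G v tok) =
      enc (combination emb (σ (σ.knowledge p t G) v) tok) :=
  LinearMap.congr_fun (σ.exists_encoder enc p G v).choose_spec tok

theorem view_eq_codedView (I : Input n k d) (G : ℕ → SimpleGraph (Fin n)) {t : ℕ}
    {sent : Fin t → Fin n → Bits m} (hsent : ∀ τ u,
      sent τ u = enc (combination emb (σ.vector I.holds (fun i : Fin t => G i) τ u) I.token))
    (v : Fin n) : CentralizedAlgorithm.view I G sent v =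
      σ.codedView enc emb I.holds (fun i : Fin t => G i) v I.token := by
  refine Prod.ext (funext fun i => ?_) (funext fun τ => funext fun u => ?_)
  · by_cases hi : i ∈ I.holds v <;> simp [CentralizedAlgorithm.view, codedView, hi]
  · by_cases hadj : (G τ).Adj u v <;> simp [CentralizedAlgorithm.view, codedView, hadj, hsent]

variable (I : Input n k d) (G : ℕ → SimpleGraph (Fin n)) (ω : ℕ → Coin s) {R : ℕ}

theorem run_algorithm_snd {t : ℕ} (ht : t < R) (v : Fin n) :
    ((σ.algorithm enc emb R).run I G ω t).2 v = none := by
  cases t with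
  | zero => exact if_neg ht.ne
  | succ t =>
    have hprev := run_algorithm_snd (t.lt_succ_self.trans ht) v
    simp only [CentralizedAlgorithm.run, hprev]
    exact if_neg ht.ne

theorem run_algorithm_fst {t : ℕ} (ht : t ≤ R) (τ : Fin t) (u : Fin n) :
    ((σ.algorithm enc emb R).run I G ω t).1 τ u =
      enc (combination emb (σ.vector I.holds (fun i : Fin t => G i) τ u) I.token) := by
  induction t generalizing u with
  | zero => exact τ.elim0
  | succ t ih =>
    have hnone := σ.run_algorithm_snd enc emb I G ω (t.lt_succ_self.trans_le ht) u
    have hview := σ.view_eq_codedView enc emb I G (ih (t.le_succ.trans ht)) u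
    refine Fin.lastCases ?_ (fun τ => ?_) τ
    · simp only [CentralizedAlgorithm.run, Fin.snoc_last, hnone, hview]
      exact σ.message_codedView enc emb R I.holds _ _ u I.token
    · simp only [CentralizedAlgorithm.run, Fin.snoc_castSucc]
      exact ih (t.le_succ.trans ht) τ u

theorem run_algorithm_eq_some (hemb : Function.Injective emb) {v : Fin n}
    (hv : σ.knowledge I.holds R (fun i => G i) v = ⊤) :
    ((σ.algorithm enc emb R).run I G ω R).2 v = some I.token := by
  have hdecision : (σ.algorithm enc emb R).decision I G ω
      ((σ.algorithm enc emb R).run I G ω R).1 v = some I.token := by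
    rw [CentralizedAlgorithm.decision,
      σ.view_eq_codedView enc emb I G (σ.run_algorithm_fst enc emb I G ω le_rfl)]
    exact (if_pos rfl).trans
      (congrArg some (Function.leftInverse_invFun (σ.codedView_injective enc hemb hv) _))
  cases R with
  | zero => exact hdecision
  | succ R =>
    have hnone := σ.run_algorithm_snd enc emb I G ω R.lt_succ_self v
    simpa [CentralizedAlgorithm.run, hnone] using hdecision

end Strategy

end Coding

section UpperBound

open Module

variable {n k d m s : ℕ} {K : Type*} [Field K] [Finite K] {a ρ : ℝ}

theorem exists_strategy_potential_knowledge_le (n k : ℕ) (ha : 1 ≤ a)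
    (hρ : n / Nat.card K + a⁻¹ ≤ ρ) :
    ∃ σ : Strategy n k K, ∀ {d : ℕ} (I : Input n k d) {t : ℕ} (G : Fin t → SimpleGraph (Fin n)),
      (∀ τ, (G τ).Connected) →
        potential a (σ.knowledge I.holds t G) ≤ ρ ^ t * ((Nat.card K : ℝ) ^ k * a ^ n) := by
  have hρ0 : 0 ≤ ρ := le_trans (by positivity) hρ
  have hround (V : Fin n → Submodule K (Fin k → K)) : ∃ x : ∀ u, V u, ⨆ v, V v = ⊤ →
      ∀ G : SimpleGraph (Fin n), G.Connected →
        potential a (spread V x G) ≤ ρ * potential a V := by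
    by_cases hV : ⨆ v, V v = ⊤
    · obtain ⟨x, hx⟩ := exists_potential_spread_le ha hV
      refine ⟨x, fun _ G hG => (hx G hG).trans ?_⟩
      rw [Fintype.card_fin]
      exact mul_le_mul_of_nonneg_right hρ (potential_nonneg ha V)
    · exact ⟨0, fun h => absurd h hV⟩
  choose σ hσ using hround
  refine ⟨σ, fun I t G hG => ?_⟩
  induction t with
  | zero => simpa [Nat.card_fun] using potential_le ha (Strategy.knowledge σ I.holds 0 G)
  | succ t ih =>
    calc potential a (Strategy.knowledge σ I.holds (t + 1) G)
        ≤ ρ * potential a (Strategy.knowledge σ I.holds t (Fin.init G)) :=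
          hσ _ (Strategy.iSup_knowledge σ I _) _ (hG _)
      _ ≤ ρ * (ρ ^ t * ((Nat.card K : ℝ) ^ k * a ^ n)) :=
          mul_le_mul_of_nonneg_left (ih _ fun τ => hG τ.castSucc) hρ0
      _ = ρ ^ (t + 1) * ((Nat.card K : ℝ) ^ k * a ^ n) := by rw [pow_succ' ρ t, mul_assoc]

theorem exists_solvesSurely [Algebra (ZMod 2) K] (enc : K ≃ₗ[ZMod 2] Bits m)
    (hdm : d ≤ m) {R : ℕ} (ha : 1 ≤ a) (hρ : n / Nat.card K + a⁻¹ ≤ ρ)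
    (hR : ρ ^ R * ((Nat.card K : ℝ) ^ k * a ^ n) < a - 1) :
    ∃ A : CentralizedAlgorithm n k d m s, A.IsNetworkCoding ∧ ∀ T, A.SolvesSurely T R := by
  obtain ⟨σ, hσ⟩ := exists_strategy_potential_knowledge_le n k ha hρ
  obtain ⟨f, hf⟩ := (finrank_le_iff_exists_linearMap (R := ZMod 2) (M := Bits d)
    (M' := Bits m)).1 (by simpa using hdm)
  let emb : Bits d →ₗ[ZMod 2] K := enc.symm.toLinearMap ∘ₗ f
  have hemb : Function.Injective emb := enc.symm.injective.comp hf
  refine ⟨σ.algorithm enc emb R, σ.algorithm_isNetworkCoding enc emb R,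
    fun T I adv hadv ω v => ?_⟩
  refine σ.run_algorithm_eq_some enc emb I _ ω hemb (eq_top_of_potential_lt ha ?_ v)
  exact (hσ I _ fun τ => (hadv ω).1 τ).trans_lt hR

end UpperBound

section Parameters

variable {n k d b : ℕ}

theorem natCard_galoisField (hb : 1 ≤ b) :
    (Nat.card (GaloisField 2 (3 * b)) : ℝ) = (2 ^ b) ^ 3 := by
  rw [GaloisField.card 2 _ (by omega), ← pow_mul, mul_comm b 3]
  norm_num

theorem div_pow_three_add_inv_sq_le {q : ℝ} (hq : 2 ≤ q) {x : ℝ} (hx : x ≤ q) :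
    x / q ^ 3 + (q ^ 2)⁻¹ ≤ q⁻¹ := by
  have hq0 : 0 < q := by linarith
  calc x / q ^ 3 + (q ^ 2)⁻¹ ≤ q / q ^ 3 + (q ^ 2)⁻¹ := by gcongr
    _ = 2 / q * q⁻¹ := by field_simp; norm_num
    _ ≤ 1 * q⁻¹ := by
        gcongr
        exact (div_le_one hq0).2 hq
    _ = q⁻¹ := one_mul _

theorem inv_pow_mul_pow_mul_pow_le_one {q : ℝ} (hq : 1 ≤ q) (hk : k ≤ n) :
    q⁻¹ ^ (5 * n) * ((q ^ 3) ^ k * (q ^ 2) ^ n) ≤ 1 := by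
  rw [inv_pow, inv_mul_le_one₀ (by positivity), ← pow_mul, ← pow_mul, ← pow_add]
  exact pow_le_pow_right₀ hq (by omega)

theorem exists_solvesSurely_five_mul (hk : k ≤ n) (hd : d ≤ b) (hb : 1 ≤ b) (hnb : n ≤ 2 ^ b) :
    ∃ A : CentralizedAlgorithm n k d (3 * b) 0,
      A.IsNetworkCoding ∧ ∀ T, A.SolvesSurely T (5 * n) := by
  let enc : GaloisField 2 (3 * b) ≃ₗ[ZMod 2] Bits (3 * b) :=
    LinearEquiv.ofFinrankEq _ _ (by rw [GaloisField.finrank 2 (by omega), Module.finrank_fin_fun])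
  have hq : (2 : ℝ) ≤ 2 ^ b := le_self_pow₀ one_le_two (by omega)
  -- With `q = 2 ^ b`, the potential starts at `q ^ (3 * k + 2 * n) ≤ q ^ (5 * n)` or less, and each
  -- round divides it by `q`.
  refine exists_solvesSurely (a := (2 ^ b) ^ 2) (ρ := (2 ^ b)⁻¹) enc (by omega) (by nlinarith) ?_ ?_
  · rw [natCard_galoisField hb]
    exact div_pow_three_add_inv_sq_le hq (by exact_mod_cast hnb)
  · rw [natCard_galoisField hb]
    exact (inv_pow_mul_pow_mul_pow_le_one (by linarith) hk).trans_lt (by nlinarith)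

end Parameters

section SolvesSurely

instance (s : ℕ) : IsProbabilityMeasure (coinMeasure s) := by
  unfold coinMeasure
  infer_instance

namespace CentralizedAlgorithm.SolvesSurely

variable {n k d m s T R : ℕ} {A : CentralizedAlgorithm n k d m s}

theorem isLasVegas (hA : A.SolvesSurely T R) : A.IsLasVegas T :=
  fun I adv hadv ω => ⟨R, hA I adv hadv ω⟩

theorem solvesWithProb (hA : A.SolvesSurely T R) {p : ℝ} (hp : p ≤ 1) :
    A.SolvesWithProb T R p := fun I adv hadv => by
  have huniv : {ω | A.SolvedBy I adv ω R} = Set.univ := Set.eq_univ_of_forall (hA I adv hadv)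
  rwa [huniv, probReal_univ]

end CentralizedAlgorithm.SolvesSurely

end SolvesSurely

section LowerBound

variable {n k d m s : ℕ}

theorem measurableSet_of_dependsOn {ι : Type*} {α : ι → Type*} [∀ i, Finite (α i)]
    [∀ i, MeasurableSpace (α i)] [∀ i, MeasurableSingletonClass (α i)] {S : Set (∀ i, α i)}
    {s : Set ι} [Finite s] (h : DependsOn (· ∈ S) s) : MeasurableSet S := by
  obtain ⟨g, hg⟩ := dependsOn_iff_exists_comp.1 h
  have hS : S = s.domRestrict ⁻¹' {x | g x} := Set.ext fun x => (congrFun hg x).to_iff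
  rw [hS]
  exact (measurable_pi_lambda _ fun i => measurable_pi_apply _) (Set.toFinite _).measurableSet

/-- The input in which node `v₀` holds all tokens. -/
def concentratedInput (v₀ : Fin n) (tok : Fin k → Bits d) : Input n k d where
  holds v := if v = v₀ then Finset.univ else ∅
  token := tok
  held i := ⟨v₀, by simp⟩

namespace CentralizedAlgorithm

theorem dependsOn_run (A : CentralizedAlgorithm n k d m s) (I : Input n k d)
    (G : ℕ → SimpleGraph (Fin n)) (t : ℕ) : DependsOn (fun ω => A.run I G ω t) (Set.Iio t) := by
  intro ω ω' h
  induction t with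
  | zero =>
    have hω : (fun i : Fin 0 => ω i) = fun i : Fin 0 => ω' i := funext fun i => i.elim0
    simp only [run, decision, hω]
  | succ t ih =>
    have hω : (fun i : Fin (t + 1) => ω i) = fun i : Fin (t + 1) => ω' i :=
      funext fun i => h i i.2
    simp only [run, decision, hω, ih fun i hi => h i (Nat.lt_succ_of_lt hi)]

section LightCone

variable (A : CentralizedAlgorithm n k d m s) {I : Input n k d} {tok : Fin k → Bits d}
  {G : ℕ → SimpleGraph (Fin n)} {δ : Fin n → ℕ}

-- `δ v` bounds from below the distance of `v` to the nodes that hold a token with changed contents.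
theorem view_eq_of_lt (hδ : ∀ t u v, (G t).Adj u v → δ v ≤ δ u + 1)
    (htok : ∀ v, 0 < δ v → ∀ i ∈ I.holds v, I.token i = tok i) {t : ℕ}
    {sent sent' : Fin t → Fin n → Bits m} (hsent : ∀ (τ : Fin t) u, τ < δ u → sent τ u = sent' τ u)
    {v : Fin n} (hv : t < δ v) : view I G sent v = view { I with token := tok } G sent' v := by
  refine Prod.ext (funext fun i => ?_) (funext fun τ => funext fun u => ?_)
  · simp only [view]
    split_ifs with hi
    · exact htok v (by omega) i hi
    · rfl
  · simp only [view]
    split_ifs with hadj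
    · exact hsent τ u (by have := hδ τ u v hadj; omega)
    · rfl

theorem run_eq_of_lt (hδ : ∀ t u v, (G t).Adj u v → δ v ≤ δ u + 1)
    (htok : ∀ v, 0 < δ v → ∀ i ∈ I.holds v, I.token i = tok i) (ω : ℕ → Coin s) (t : ℕ) :
    (∀ (τ : Fin t) u, τ < δ u →
      (A.run I G ω t).1 τ u = (A.run { I with token := tok } G ω t).1 τ u) ∧
    ∀ v, t < δ v → (A.run I G ω t).2 v = (A.run { I with token := tok } G ω t).2 v := by
  induction t with
  | zero =>
    exact ⟨fun τ => τ.elim0, fun v hv =>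
      congrArg (A.output 0 I.holds _ _ v) (view_eq_of_lt hδ htok (fun τ => τ.elim0) hv)⟩
  | succ t ih =>
    obtain ⟨ihsent, ihresult⟩ := ih
    have hsent : ∀ (τ : Fin (t + 1)) u, τ < δ u → (A.run I G ω (t + 1)).1 τ u =
        (A.run { I with token := tok } G ω (t + 1)).1 τ u := by
      refine fun τ u => Fin.lastCases (fun hu => ?_) (fun τ hu => ?_) τ
      · simp only [run, Fin.snoc_last, ihresult u hu, view_eq_of_lt hδ htok ihsent hu]
      · simpa only [run, Fin.snoc_castSucc] using ihsent τ u hu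
    refine ⟨hsent, fun v hv => ?_⟩
    have hdecision : A.decision I G ω (A.run I G ω (t + 1)).1 v =
        A.decision { I with token := tok } G ω (A.run { I with token := tok } G ω (t + 1)).1 v :=
      congrArg (A.output (t + 1) I.holds _ _ v) (view_eq_of_lt hδ htok hsent hv)
    simp only [run] at hdecision ⊢
    rw [hdecision, ihresult v (t.lt_succ_self.trans hv)]

end LightCone

theorem SolvesWithProb.le_succ {A : CentralizedAlgorithm n k d m s} {T R : ℕ} {p : ℝ}
    (hA : A.SolvesWithProb T R p) (hk : 1 ≤ k) (hd : 1 ≤ d) (hp : 1 / 2 < p) : n ≤ R + 1 := by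
  by_contra! hR
  obtain ⟨l, rfl⟩ : ∃ l, n = l + 1 := ⟨n - 1, by omega⟩
  let adv : Adversary (l + 1) s := fun _ _ => SimpleGraph.pathGraph (l + 1)
  have hadv : adv.IsStable T :=
    fun _ => ⟨fun _ => SimpleGraph.pathGraph_connected l, fun _ _ _ => rfl⟩
  let S (tok : Fin k → Bits d) : Set (ℕ → Coin s) :=
    {ω | A.SolvedBy (concentratedInput 0 tok) adv ω R}
  have hmeas : MeasurableSet (S 1) := measurableSet_of_dependsOn (s := Set.Iio R) fun ω ω' h =>
    congrArg (fun r : _ × (Fin (l + 1) → Option (Fin k → Bits d)) => ∀ v, r.2 v = some 1)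
      (A.dependsOn_run (concentratedInput 0 1) (fun _ => SimpleGraph.pathGraph (l + 1)) R h)
  have hprob (tok : Fin k → Bits d) : p ≤ (coinMeasure s).real (S tok) := hA _ adv hadv
  obtain ⟨ω, h0, h1⟩ : (S 0 ∩ S 1).Nonempty := by
    refine nonempty_inter_of_measureReal_lt_add (μ := coinMeasure s) hmeas (Set.subset_univ _)
      (Set.subset_univ _) ?_
    rw [probReal_univ]
    linarith [hprob 0, hprob 1]
  have hlast := (A.run_eq_of_lt (I := concentratedInput 0 0) (tok := 1)
    (G := fun _ => SimpleGraph.pathGraph (l + 1)) (δ := Fin.val)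
    (fun _ u v h => by rcases SimpleGraph.pathGraph_adj.1 h with h | h <;> omega)
    (fun v hv => by simp [concentratedInput, Fin.pos_iff_ne_zero.1 hv]) ω R).2 (Fin.last l)
    (by simp only [Fin.val_last]; omega)
  have htok : (0 : Fin k → Bits d) = 1 :=
    Option.some_injective _ ((h0 (Fin.last l)).symm.trans (hlast.trans (h1 (Fin.last l))))
  exact zero_ne_one (congrFun (congrFun htok ⟨0, hk⟩) ⟨0, hd⟩)

end CentralizedAlgorithm

end LowerBound

theorem le_two_pow_of_logb_le {n b : ℕ} (hn : 1 ≤ n) (hnb : Real.logb 2 n ≤ b) : n ≤ 2 ^ b := by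
  have h := (Real.logb_le_iff_le_rpow one_lt_two (by exact_mod_cast hn)).1 hnb
  rw [Real.rpow_natCast] at h
  exact_mod_cast h

theorem half_lt_one_sub_half_pow {n : ℕ} (hn : 2 ≤ n) : (1 / 2 : ℝ) < 1 - 2⁻¹ ^ n := by
  have h : (2⁻¹ : ℝ) ^ n ≤ 2⁻¹ ^ 2 := pow_le_pow_of_le_one (by norm_num) (by norm_num) hn
  norm_num at h ⊢
  linarith

theorem corollary8_general :
    (∃ c C : ℕ, ∀ n k d b : ℕ, k ≤ n → d ≤ b → 1 ≤ b → n ≤ 2 ^ b →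
      ∃ A : CentralizedAlgorithm n k d (c * b) 0,
        A.IsNetworkCoding ∧ ∀ T, A.SolvesSurely T (C * n)) ∧
    ∀ (n k d m s T R : ℕ) (p : ℝ), 1 ≤ k → 1 ≤ d → 1 / 2 < p →
      ∀ A : CentralizedAlgorithm n k d m s, A.SolvesWithProb T R p → n ≤ R + 1 :=
  ⟨⟨3, 5, fun _ _ _ _ hk hd hb hnb => exists_solvesSurely_five_mul hk hd hb hnb⟩,
    fun _ _ _ _ _ _ _ _ hk hd hp _ hA => hA.le_succ hk hd hp⟩

end DynamicNetwork

theorem corollary8 :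
    -- randomized: `O(n)` rounds with probability at least `1 - 2^(-n)`
    (∃ c C : ℕ, ∀ n k d b T : ℕ, 1 ≤ n → k ≤ n → d ≤ b → 1 ≤ b → Real.logb 2 n ≤ b → 1 ≤ T →
      ∃ (s : ℕ) (A : CentralizedAlgorithm n k d (c * b) s),
        A.IsNetworkCoding ∧ A.IsLasVegas T ∧
        A.SolvesWithProb T (C * n) (1 - 2⁻¹ ^ n)) ∧
    -- order-optimality: every centralized algorithm needs at least `n - 1` rounds
    (∀ n k d m s T R : ℕ, 1 ≤ k → k ≤ n → 1 ≤ d → 1 ≤ T →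
      ∀ A : CentralizedAlgorithm n k d m s,
        A.SolvesWithProb T R (1 - 2⁻¹ ^ n) → n ≤ R + 1) ∧
    -- deterministic
    (∃ (c : ℕ) (C : ℝ), ∀ n k d b T : ℕ,
      1 ≤ n → k ≤ n → d ≤ b → 1 ≤ b → Real.logb 2 n ≤ b → 1 ≤ T →
      ∃ (A : CentralizedAlgorithm n k d (c * b) 0) (R : ℕ),
        A.IsNetworkCoding ∧ A.SolvesSurely T R ∧
        (R : ℝ) ≤ C * (Real.logb 2 n / (b * T) * n * min (k : ℝ) ((n : ℝ) / T) + n)) := by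
  obtain ⟨⟨c, C, hupper⟩, hlower⟩ := corollary8_general
  refine ⟨⟨c, C, fun n k d b T hn hk hd hb hnb _ => ?_⟩,
    fun n k d m s T R hk _ hd _ A hA => ?_, c, C, fun n k d b T hn hk hd hb hnb _ => ?_⟩
  · obtain ⟨A, hcoding, hsolves⟩ := hupper n k d b hk hd hb (le_two_pow_of_logb_le hn hnb)
    exact ⟨0, A, hcoding, (hsolves T).isLasVegas,
      (hsolves T).solvesWithProb (sub_le_self 1 (by positivity))⟩
  · rcases le_or_gt n 1 with hn | hn
    · omega
    · exact hlower n k d m s T R _ hk hd (half_lt_one_sub_half_pow hn) A hA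
  · obtain ⟨A, hcoding, hsolves⟩ := hupper n k d b hk hd hb (le_two_pow_of_logb_le hn hnb)
    refine ⟨A, C * n, hcoding, hsolves T, ?_⟩
    have hlog : 0 ≤ Real.logb 2 n := Real.logb_nonneg one_lt_two (by exact_mod_cast hn)
    push_cast
    gcongr
    exact le_add_of_nonneg_left (by positivity)
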